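/- Let $n,n_{in},n_{mid}$ be non-negative integers, let $G\le S_n$ be a permutation group, acting on arrays $x=(x_1,\dots,x_n)\in\mathbb{R}^{n\times n_{in}}$, $x_i\in\mathbb{R}^{n_{in}}$, by $g(x)=(x_{g(1)},\dots,x_{g(n)})$, and let $\tau,\sigma:\mathbb{R}\to\mathbb{R}$ be continuous functions that are not polynomials (possibly $\tau=\sigma$). Let $\mathcal F$ be a finite set of real polynomials in the $n\cdot n_{in}$ entries of $x$ that generates the $\mathbb{R}$-algebra of all $G$-invariant polynomials, let $N_{inv}$ be its number of elements, and assume $n_{mid}\ge N_{inv}$. Let $V\subset\mathbb{R}^{n\times n_{in}}$ be compact and let $f:V\to\mathbb{R}$ be continuous and $G$-invariant, i.e. $f(g(x))=f(x)$ whenever $g\in G$ and $x,g(x)\in V$. Then for every $\varepsilon>0$ there are networks $\phi_1,\dots,\phi_n:\mathbb{R}^{n_{in}}\to\mathbb{R}^{n_{mid}}$ with one hidden layer and activation $\tau$, and a network $f_{out}:\mathbb{R}^{n_{mid}}\to\mathbb{R}$ with one hidden layer and activation $\sigma$, such that $$|f(x)-\Gamma(x)|<\varepsilon\quad\text{for all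 }x\in V,\qquad \Gamma(x)=f_{out}\bigl(\Sigma\Pi(f_{in}(x))\bigr).$$ Here $f_{in}(x)=(\phi_j(x_i))_{i,j=1}^n\in\mathbb{R}^{n\times n\times n_{mid}}$ and $\Sigma\Pi(y)=\sum_{g\in G}\prod_{j=1}^n y_{g(j),j}\in\mathbb{R}^{n_{mid}}$, where the product is taken separately in each of the $n_{mid}$ coordinates. A network $\mathbb{R}^d\to\mathbb{R}^m$ with one hidden layer and activation $\rho$ is a map whose $k$-th coordinate is $x\mapsto\sum_{i=1}^{N}c_{k,i}\,\rho\bigl(\sum_{j=1}^{d}w_{i,j}x_j+h_i\bigr)$, with an integer $N\ge1$ and real numbers $c_{k,i},w_{i,j},h_i$. -/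

import Mathlib

namespace GInvNet

/-- The input space of `n × d` real arrays `x = (x_1, …, x_n)`, with `x_i ∈ ℝ^d`. -/
abbrev Arr (n d : ℕ) : Type := Fin n → Fin d → ℝ

/-- The action of a permutation on an array: `g(x) = (x_{g(1)}, …, x_{g(n)})`. -/
def permAct {n d : ℕ} (g : Equiv.Perm (Fin n)) (x : Arr n d) : Arr n d :=
  fun i => x (g i)

/-- `f` is `G`-invariant on `V`: `f (g(x)) = f x` whenever `g ∈ G` and both `x` and `g(x)`
lie in `V`. The set `V` itself need not be stable under `G`. -/
def InvariantOn {n d : ℕ} (G : Subgroup (Equiv.Perm (Fin n))) (V : Set (Arr n d))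
    (f : Arr n d → ℝ) : Prop :=
  ∀ g ∈ G, ∀ x ∈ V, permAct g x ∈ V → f (permAct g x) = f x

/-- The function on arrays given by a real polynomial in the `n * d` entries. -/
noncomputable def polyFun {n d : ℕ} (p : MvPolynomial (Fin n × Fin d) ℝ) (x : Arr n d) : ℝ :=
  MvPolynomial.eval (fun s => x s.1 s.2) p

/-- The algebra of polynomial `G`-invariants on the space of all `n × d` arrays. -/
noncomputable def invariantPolys {n : ℕ} (d : ℕ) (G : Subgroup (Equiv.Perm (Fin n))) :
    Subalgebra ℝ (MvPolynomial (Fin n × Fin d) ℝ) where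
  carrier := {p | InvariantOn G Set.univ (polyFun p)}
  mul_mem' := by
    intro p q hp hq g hg x hx hgx
    have h1 := hp g hg x hx hgx
    have h2 := hq g hg x hx hgx
    simp only [polyFun, map_mul] at *
    rw [h1, h2]
  add_mem' := by
    intro p q hp hq g hg x hx hgx
    have h1 := hp g hg x hx hgx
    have h2 := hq g hg x hx hgx
    simp only [polyFun, map_add] at *
    rw [h1, h2]
  algebraMap_mem' := by
    intro r g hg x hx hgx
    simp [polyFun, MvPolynomial.algebraMap_eq]

/-- `σ` is not (the function of) a polynomial. -/
def NonPolynomial (σ : ℝ → ℝ) : Prop :=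
  ¬ ∃ p : Polynomial ℝ, ∀ t : ℝ, σ t = p.eval t

/-- The parameters of a fully connected network `ℝ^d → ℝ^m` with one hidden layer of `N ≥ 1`
units. -/
structure ShallowNet (d m : ℕ) where
  /-- The number of hidden units. -/
  N : ℕ
  /-- There is at least one hidden unit. -/
  N_pos : 0 < N
  /-- The weights of the hidden layer. -/
  w : Fin N → Fin d → ℝ
  /-- The biases of the hidden layer. -/
  h : Fin N → ℝ
  /-- The coefficients of the linear output layer. -/
  c : Fin m → Fin N → ℝ

/-- The function of a one-hidden-layer network with activation `σ`: its `k`-th output is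
`∑ i, c_{k,i} σ (∑ j, w_{i,j} x_j + h_i)`. -/
noncomputable def ShallowNet.realize {d m : ℕ} (σ : ℝ → ℝ) (φ : ShallowNet d m)
    (x : Fin d → ℝ) : Fin m → ℝ :=
  fun k => ∑ i, φ.c k i * σ (∑ j, φ.w i j * x j + φ.h i)

/-- The input transformation: the entry in row `i` and column `j` of `f_in x` is the feature
vector `φ_j (x_i)`. -/
def fIn {n d m : ℕ} (φ : Fin n → (Fin d → ℝ) → (Fin m → ℝ)) (x : Arr n d) :
    Fin n → Fin n → Fin m → ℝ :=
  fun i j => φ j (x i)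

open scoped Classical in
/-- The sum-product layer, `ΣΠ (y) = ∑_{g ∈ G} ∏_j y_{g(j), j}`, computed separately in each of
the `m` features. -/
noncomputable def sumProd {n m : ℕ} (G : Subgroup (Equiv.Perm (Fin n)))
    (y : Fin n → Fin n → Fin m → ℝ) : Fin m → ℝ :=
  ∑ g : G, ∏ j : Fin n, y ((g : Equiv.Perm (Fin n)) j) j

/-- The `G`-invariant network `Γ = f_out ∘ ΣΠ ∘ f_in`. The networks `φ_j` of the input
transformation have activation `τ`, the output network has activation `σ`. -/
noncomputable def network {n d m o : ℕ} (τ σ : ℝ → ℝ) (G : Subgroup (Equiv.Perm (Fin n)))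
    (φ : Fin n → ShallowNet d m) (ψ : ShallowNet m o) (x : Arr n d) : Fin o → ℝ :=
  ψ.realize σ (sumProd G (fIn (fun j => (φ j).realize τ) x))

end GInvNet

/-! If `φ_j` is the row-`j` factor of a monomial, then `ΣΠ ∘ f_in` is the orbit sum of that monomial
(`polyFun_orbitSum_monomial`). It is enough that `nMid` orbit sums of monomials generate the
invariants. Invariants separate orbits, so `f` then factors on `V` through these sums as a
continuous function on a compact set. That function is approximated by a `σ`-network and the row
factors by `τ`-networks.

The count is a Nakayama argument. Let `M` be the space of invariants without constant term. The
elements of `F`, less their constants, span `M` modulo `M * M`, so this quotient has dimension at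
most `F.card`. Orbit sums of monomials span `M`, so at most `F.card` of them span the quotient, and
being homogeneous these generate the algebra (`exists_orbitSum_generators`).

Universal approximation rests on `pow_mem_of_ridge_mem`: a closed subspace containing all `σ (s * u
+ b)` contains every `u ^ k`. Hence it contains `exp u`, and Stone–Weierstrass applies to
exponentials of linear forms. -/

open Filter Topology MeasureTheory
open scoped Convolution

namespace GInvNet

/-! ### Mollifications of a non-polynomial function -/

/-- A real function whose iterated derivative of order `k` vanishes is a polynomial of degree
less than `k`. -/
lemma exists_polynomial_of_iteratedDeriv_eq_zero (k : ℕ) (ψ : ℝ → ℝ) (hψ : ContDiff ℝ k ψ)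
    (h : ∀ t, iteratedDeriv k ψ t = 0) :
    ∃ p : Polynomial ℝ, p.degree < k ∧ ∀ t, ψ t = p.eval t := by
  induction k generalizing ψ with
  | zero => exact ⟨0, by simp [Polynomial.degree_zero], fun t => by simpa using h t⟩
  | succ k ih =>
    have hd : ContDiff ℝ k (deriv ψ) := ((contDiff_succ_iff_deriv (n := k)).1 (by simpa using hψ)).2.2
    obtain ⟨p, hp, hpe⟩ := ih (deriv ψ) hd fun t => by rw [← iteratedDeriv_succ']; exact h t
    have hdiff : Differentiable ℝ ψ := hψ.differentiable (by simp)
    let q : Polynomial ℝ := ∑ i ∈ Finset.range k, Polynomial.monomial (i + 1) (p.coeff i / (i + 1))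
    have hq : q.derivative = p := by
      ext m
      rw [Polynomial.coeff_derivative, Polynomial.finsetSum_coeff]
      simp only [Polynomial.coeff_monomial, Nat.add_right_cancel_iff, Finset.sum_ite_eq',
        Finset.mem_range]
      split_ifs with hm
      · field_simp
      · rw [zero_mul, Polynomial.coeff_eq_zero_of_degree_lt]
        exact hp.trans_le (by exact_mod_cast not_lt.1 hm)
    refine ⟨Polynomial.C (ψ 0 - q.eval 0) + q, ?_, ?_⟩
    · refine (Polynomial.degree_add_le _ _).trans_lt (max_lt ?_ ?_)
      · exact Polynomial.degree_C_le.trans_lt (by exact_mod_cast Nat.succ_pos k)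
      · refine (Polynomial.degree_sum_le _ _).trans_lt ?_
        rw [Finset.sup_lt_iff (WithBot.bot_lt_coe _)]
        intro i hi
        refine (Polynomial.degree_monomial_le _ _).trans_lt ?_
        have := Finset.mem_range.1 hi
        exact_mod_cast Nat.succ_lt_succ this
    · intro t
      have hc : ∀ x y, (fun t => ψ t - q.eval t) x = (fun t => ψ t - q.eval t) y := by
        refine is_const_of_deriv_eq_zero (hdiff.sub q.differentiable) fun x => ?_
        have h1 := (hdiff x).hasDerivAt.sub (q.hasDerivAt x)
        refine h1.deriv.trans ?_
        rw [hq, hpe x, sub_self]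
      have := hc t 0
      simp only [Polynomial.eval_add, Polynomial.eval_C] at this ⊢
      linarith

/-- A pointwise limit of polynomials of degree less than `k` is a polynomial. -/
lemma exists_polynomial_of_tendsto {ι : Type*} {l : Filter ι} [l.NeBot] (k : ℕ)
    (p : ι → Polynomial ℝ) (hp : ∀ i, (p i).degree < k) (f : ℝ → ℝ)
    (hf : ∀ t, Tendsto (fun i => (p i).eval t) l (𝓝 (f t))) :
    ∃ q : Polynomial ℝ, ∀ t, f t = q.eval t := by
  -- The values at `0, …, k - 1` determine such a polynomial linearly, so the limit is the Lagrange
  -- interpolant of `f` at these nodes.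
  have hinj : Set.InjOn (fun i : ℕ => (i : ℝ)) (Finset.range k : Set ℕ) :=
    Nat.cast_injective.injOn
  refine ⟨Lagrange.interpolate (Finset.range k) (fun i : ℕ => (i : ℝ)) fun i => f i, fun t => ?_⟩
  refine tendsto_nhds_unique (hf t) ?_
  have h : ∀ i, (p i).eval t = ∑ j ∈ Finset.range k, (p i).eval (j : ℝ) *
      (Lagrange.basis (Finset.range k) (fun i : ℕ => (i : ℝ)) j).eval t := fun i => by
    conv_lhs => rw [Lagrange.eq_interpolate hinj (f := p i) (by simpa using hp i)]
    simp [Lagrange.interpolate_apply, Polynomial.eval_finsetSum]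
  simp only [h, Lagrange.interpolate_apply, Polynomial.eval_finsetSum, Polynomial.eval_mul,
    Polynomial.eval_C]
  exact tendsto_finsetSum _ fun j _ => (hf j).mul_const _

/-- The mollification of a continuous function by a normed bump function. -/
noncomputable def mollify (φ : ContDiffBump (0 : ℝ)) (σ : ℝ → ℝ) : ℝ → ℝ :=
  φ.normed volume ⋆[ContinuousLinearMap.lsmul ℝ ℝ, volume] σ

lemma contDiff_mollify (φ : ContDiffBump (0 : ℝ)) {σ : ℝ → ℝ} (hσ : Continuous σ) (k : ℕ) :
    ContDiff ℝ k (mollify φ σ) :=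
  HasCompactSupport.contDiff_convolution_left (n := k) _ φ.hasCompactSupport_normed
    φ.contDiff_normed hσ.locallyIntegrable

/-- Otherwise every mollification is a polynomial of degree less than `k`. Shrinking the bumps gives
`σ` as a pointwise limit of these, hence a polynomial. -/
lemma exists_iteratedDeriv_mollify_ne_zero {σ : ℝ → ℝ} (hσ : Continuous σ)
    (hσ' : NonPolynomial σ) (k : ℕ) :
    ∃ (φ : ContDiffBump (0 : ℝ)) (b : ℝ), iteratedDeriv k (mollify φ σ) b ≠ 0 := by
  by_contra! hcon
  let φ : ℕ → ContDiffBump (0 : ℝ) := fun i =>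
    ⟨1 / (2 * ((i : ℝ) + 1)), 1 / ((i : ℝ) + 1), by positivity, by
      apply one_div_lt_one_div_of_lt <;> first | positivity | linarith [(Nat.cast_nonneg i : (0:ℝ) ≤ i)]⟩
  choose p hp hpe using fun i => exists_polynomial_of_iteratedDeriv_eq_zero k (mollify (φ i) σ)
    (contDiff_mollify _ hσ k) (hcon (φ i))
  refine hσ' (exists_polynomial_of_tendsto (l := atTop) k p hp σ fun t => ?_)
  simp only [← hpe]
  exact ContDiffBump.convolution_tendsto_right_of_continuous
    tendsto_one_div_add_atTop_nhds_zero_nat hσ t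

/-! ### Closed subspaces of `C(X, ℝ)` containing ridge functions -/

section Ridge

variable {X : Type*} [TopologicalSpace X]

/-- The ridge function `x ↦ ψ (s * u x + b)`. -/
def ridge (ψ : C(ℝ, ℝ)) (u : C(X, ℝ)) (s b : ℝ) : C(X, ℝ) :=
  ⟨fun x => ψ (s * u x + b), by fun_prop⟩

lemma ridge_apply (ψ : C(ℝ, ℝ)) (u : C(X, ℝ)) (s b : ℝ) (x : X) :
    ridge ψ u s b x = ψ (s * u x + b) := rfl

lemma continuous_ridge (ψ : C(ℝ, ℝ)) (u : C(X, ℝ)) :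
    Continuous fun q : ℝ × ℝ => ridge ψ u q.1 q.2 :=
  ContinuousMap.continuous_of_continuous_uncurry _ (by
    simp only [Function.uncurry_def, ridge_apply]; fun_prop)

variable [CompactSpace X]

/-- The integral of a function with values in a closed subspace lies in the subspace. -/
lemma integral_mem_of_isClosed {α E : Type*} [MeasurableSpace α] {μ : Measure α}
    [NormedAddCommGroup E] [NormedSpace ℝ E] [CompleteSpace E] (N : Submodule ℝ E)
    (hN : IsClosed (N : Set E)) {f : α → E} (hf : ∀ a, f a ∈ N) : ∫ a, f a ∂μ ∈ N := by
  by_cases hi : Integrable f μ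
  -- Integration commutes with the quotient map by `N`, which kills the integrand. Closedness of `N`
  -- serves as an instance for the quotient.
  · have := hN
    have h := N.mkQL.integral_comp_comm hi
    rw [← Submodule.Quotient.mk_eq_zero]
    refine Eq.trans h.symm ?_
    have h0 : ∀ a, N.mkQL (f a) = 0 := fun a => (Submodule.Quotient.mk_eq_zero _).2 (hf a)
    simp [h0]
  · rw [integral_undef hi]; exact N.zero_mem

/-- Mollifying averages over shifts of the bias `b`, so the new ridge function is a `C(X, ℝ)`-valued
integral of old ones. -/
lemma ridge_mollify_mem (N : Submodule ℝ C(X, ℝ)) (hN : IsClosed (N : Set C(X, ℝ)))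
    (σ : C(ℝ, ℝ)) (u : C(X, ℝ)) (h : ∀ s b, ridge σ u s b ∈ N) (φ : ContDiffBump (0 : ℝ))
    (ψ : C(ℝ, ℝ)) (hψ : ⇑ψ = mollify φ σ) (s b : ℝ) : ridge ψ u s b ∈ N := by
  have hc : Continuous fun y => φ.normed volume y • ridge σ u s (b - y) :=
    φ.continuous_normed.smul ((continuous_ridge σ u).comp (f := fun y => (s, b - y)) (by fun_prop))
  have hi : Integrable (fun y => φ.normed volume y • ridge σ u s (b - y)) :=
    hc.integrable_of_hasCompactSupport φ.hasCompactSupport_normed.smul_right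
  have : ridge ψ u s b = ∫ y, φ.normed volume y • ridge σ u s (b - y) := by
    ext x
    rw [ContinuousMap.integral_apply hi, ridge_apply, hψ, mollify, convolution_def]
    simp [ridge_apply, add_sub_assoc]
  rw [this]
  exact integral_mem_of_isClosed N hN fun y => N.smul_mem _ (h _ _)

/-- A closed subspace of `C(X, ℝ)` that contains the functions `v * ψ (s * u + b)` also contains
their derivatives in `s`. -/
lemma mul_ridge_deriv_mem (N : Submodule ℝ C(X, ℝ)) (hN : IsClosed (N : Set C(X, ℝ)))
    (ψ ψ' : C(ℝ, ℝ)) (hψ : ∀ t, HasDerivAt ψ (ψ' t) t) (u v : C(X, ℝ))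
    (h : ∀ s b, v * ridge ψ u s b ∈ N) (s b : ℝ) : v * u * ridge ψ' u s b ∈ N := by
  have hc : Continuous fun r : ℝ => v * u * ridge ψ' u r b :=
    continuous_const.mul ((continuous_ridge ψ' u).comp (f := fun r => (r, b)) (by fun_prop))
  -- The fundamental theorem of calculus, checked pointwise but stated in `C(X, ℝ)`, gives
  -- differentiability in the sup norm.
  have hG : ∀ r, v * ridge ψ u r b =
      v * ridge ψ u 0 b + ∫ t in (0 : ℝ)..r, v * u * ridge ψ' u t b := fun r => by
    ext x
    have h1 := (ContinuousMap.evalCLM ℝ x).intervalIntegral_comp_comm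
      (hc.intervalIntegrable (μ := volume) 0 r)
    simp only [ContinuousMap.evalCLM_apply] at h1
    rw [ContinuousMap.add_apply, ← h1, intervalIntegral.integral_eq_sub_of_hasDerivAt
      (f := fun t => (v * ridge ψ u t b) x)]
    · ring
    · intro t _
      have h2 : HasDerivAt (fun t : ℝ => t * u x + b) (u x) t := by
        simpa using ((hasDerivAt_id t).mul_const (u x)).add_const b
      have h3 := ((hψ (t * u x + b)).comp t h2).const_mul (v x)
      refine h3.congr_deriv ?_
      simp only [ContinuousMap.mul_apply, ridge_apply]; ring
    · exact ((ContinuousMap.evalCLM ℝ x).continuous.comp hc).intervalIntegrable 0 r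
  have hd : HasDerivAt (fun r => v * ridge ψ u r b) (v * u * ridge ψ' u s b) s := by
    rw [funext hG]
    exact (intervalIntegral.integral_hasDerivAt_right (hc.intervalIntegrable 0 s)
      (hc.stronglyMeasurableAtFilter _ _) hc.continuousAt).const_add _
  have hr := range_deriv_subset_closure_span_image (fun r => v * ridge ψ u r b) dense_univ
    ⟨s, hd.deriv⟩
  refine closure_minimal (Submodule.span_le.2 ?_) hN hr
  rintro _ ⟨r, -, rfl⟩
  exact h r b

/-- Each derivative in `s` brings down one factor `u`. -/
lemma pow_mul_ridge_iteratedDeriv_mem (N : Submodule ℝ C(X, ℝ)) (hN : IsClosed (N : Set C(X, ℝ)))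
    (u : C(X, ℝ)) (k : ℕ) (ψ ψ' : C(ℝ, ℝ)) (hψ : ContDiff ℝ k ψ)
    (hψ' : ⇑ψ' = iteratedDeriv k ψ) (h : ∀ s b, ridge ψ u s b ∈ N) (s b : ℝ) :
    u ^ k * ridge ψ' u s b ∈ N := by
  induction k generalizing ψ' s b with
  | zero =>
    have : ψ' = ψ := by ext t; simp [hψ']
    simpa [this] using h s b
  | succ k ih =>
    have hk : ContDiff ℝ k ψ := hψ.of_le (by exact_mod_cast Nat.le_succ k)
    let χ : C(ℝ, ℝ) := ⟨iteratedDeriv k ψ, hk.continuous_iteratedDeriv k le_rfl⟩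
    rw [pow_succ]
    refine mul_ridge_deriv_mem N hN χ ψ' (fun t => ?_) u (u ^ k) (fun s b => ih χ hk rfl s b) s b
    rw [hψ', iteratedDeriv_succ]
    exact ((hψ.differentiable_iteratedDeriv k (by exact_mod_cast Nat.lt_succ_self k)) t).hasDerivAt

/-- At `s = 0` the ridge factor is constant, equal to the `k`-th derivative of a mollification at
`b`. With `b` chosen so that this is nonzero, it can be divided out. -/
lemma pow_mem_of_ridge_mem (N : Submodule ℝ C(X, ℝ)) (hN : IsClosed (N : Set C(X, ℝ)))
    (σ : C(ℝ, ℝ)) (hσ : NonPolynomial σ) (u : C(X, ℝ)) (h : ∀ s b, ridge σ u s b ∈ N) (k : ℕ) :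
    u ^ k ∈ N := by
  obtain ⟨φ, b, hb⟩ := exists_iteratedDeriv_mollify_ne_zero σ.continuous hσ k
  have hk := contDiff_mollify φ σ.continuous k
  have := pow_mul_ridge_iteratedDeriv_mem N hN u k ⟨mollify φ σ, hk.continuous⟩
    ⟨iteratedDeriv k (mollify φ σ), hk.continuous_iteratedDeriv k le_rfl⟩ hk rfl
    (ridge_mollify_mem N hN σ u h φ _ rfl) 0 b
  convert N.smul_mem (iteratedDeriv k (mollify φ σ) b)⁻¹ this using 1
  ext x
  simp [ridge_apply]
  field_simp

/-- The exponential series converges in the Banach algebra `C(X, ℝ)`. -/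
lemma exp_mem_of_pow_mem (N : Submodule ℝ C(X, ℝ)) (hN : IsClosed (N : Set C(X, ℝ)))
    (u : C(X, ℝ)) (h : ∀ k, u ^ k ∈ N) (e : C(X, ℝ)) (he : ∀ x, e x = Real.exp (u x)) : e ∈ N := by
  have hs := NormedSpace.exp_series_hasSum_exp' (𝕂 := ℝ) u
  have : e = NormedSpace.exp u := by
    ext x
    have h1 := (ContinuousMap.evalCLM ℝ x).hasSum hs
    have h2 := NormedSpace.exp_series_hasSum_exp' (𝕂 := ℝ) (u x)
    rw [he, Real.exp_eq_exp_ℝ]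
    refine h2.unique ?_
    simpa using h1
  rw [this]
  exact hN.mem_of_tendsto hs (Eventually.of_forall fun s => N.sum_mem fun k _ => N.smul_mem _ (h k))

end Ridge

/-! ### Universal approximation by shallow networks -/

section Universal

variable {d : ℕ}

/-- The linear form `x ↦ ∑ j, v j * x j` on a subset of `ℝ^d`. -/
def linForm (K : Set (Fin d → ℝ)) (v : Fin d → ℝ) : C(K, ℝ) :=
  ⟨fun x => ∑ j, v j * x.1 j, continuous_finsetSum _ fun j _ =>
    continuous_const.mul ((continuous_apply j).comp continuous_subtype_val)⟩

/-- The exponential of a linear form on a subset of `ℝ^d`. -/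
noncomputable def expForm (K : Set (Fin d → ℝ)) : Multiplicative (Fin d → ℝ) →* C(K, ℝ) where
  toFun v := ⟨fun x => Real.exp (linForm K v.toAdd x), by fun_prop⟩
  map_one' := by ext x; simp [linForm]
  map_mul' v w := by
    ext x; simp [linForm, ← Real.exp_add, add_mul, Finset.sum_add_distrib]

/-- Exponentials of linear forms are closed under products, unlike powers of linear forms. Their
span is therefore a subalgebra, it separates points, and Stone–Weierstrass applies. -/
lemma eq_top_of_ridge_mem (K : Set (Fin d → ℝ)) [CompactSpace K] (N : Submodule ℝ C(K, ℝ))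
    (hN : IsClosed (N : Set C(K, ℝ))) (σ : C(ℝ, ℝ)) (hσ : NonPolynomial σ)
    (h : ∀ v s b, ridge σ (linForm K v) s b ∈ N) : N = ⊤ := by
  let S : Submonoid C(K, ℝ) := MonoidHom.mrange (expForm K)
  let A : Subalgebra ℝ C(K, ℝ) := Algebra.adjoin ℝ (S : Set C(K, ℝ))
  have hA : A.toSubmodule ≤ N := by
    rw [Algebra.adjoin_eq_span_of_subset _ (by
      rw [Submonoid.closure_eq]; exact Submodule.subset_span), Submodule.span_le]
    rintro _ ⟨v, rfl⟩
    exact exp_mem_of_pow_mem N hN (linForm K v.toAdd)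
      (pow_mem_of_ridge_mem N hN σ hσ _ (h v.toAdd)) _ fun x => rfl
  have hsep : A.SeparatesPoints := by
    intro x y hxy
    obtain ⟨j, hj⟩ : ∃ j, x.1 j ≠ y.1 j := by
      by_contra! hcon; exact hxy (Subtype.ext (funext hcon))
    refine ⟨_, ⟨expForm K (Multiplicative.ofAdd (Pi.single j 1)),
      Algebra.subset_adjoin ⟨_, rfl⟩, rfl⟩, ?_⟩
    simpa [expForm, linForm, Pi.single_apply] using hj
  rw [eq_top_iff]
  intro g _
  have hg := ContinuousMap.continuousMap_mem_subalgebra_closure_of_separatesPoints A hsep g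
  exact closure_minimal (fun a ha => hA ha) hN hg

/-- Universal approximation by networks with one hidden layer, for a single output. -/
lemma exists_shallowNet_single_near (K : Set (Fin d → ℝ)) (hK : IsCompact K) {σ : ℝ → ℝ}
    (hσ : Continuous σ) (hσ' : NonPolynomial σ) (g : C(K, ℝ)) {δ : ℝ} (hδ : 0 < δ) :
    ∃ ψ : ShallowNet d 1, ∀ x : K, |g x - ψ.realize σ x 0| < δ := by
  have := isCompact_iff_compactSpace.1 hK
  let r : (Fin d → ℝ) × ℝ → C(K, ℝ) := fun q => ridge ⟨σ, hσ⟩ (linForm K q.1) 1 q.2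
  have htop : (Submodule.span ℝ (Set.range r)).topologicalClosure = ⊤ := by
    refine eq_top_of_ridge_mem K _ (Submodule.isClosed_topologicalClosure _) ⟨σ, hσ⟩ hσ'
      fun v s b => Submodule.le_topologicalClosure _ (Submodule.subset_span ⟨(s • v, b), ?_⟩)
    ext x
    simp [r, ridge_apply, linForm, Finset.mul_sum, mul_assoc]
  have hg : g ∈ closure (Submodule.span ℝ (Set.range r) : Set C(K, ℝ)) := by
    rw [← Submodule.topologicalClosure_coe, htop]; trivial
  obtain ⟨a, ha, hga⟩ := Metric.mem_closure_iff.1 hg δ hδ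
  obtain ⟨c, rfl⟩ := (Finsupp.mem_span_range_iff_exists_finsupp).1 ha
  let e := c.support.equivFin
  -- A zero unit is prepended because `c.support` may be empty while a network needs a unit.
  let w : Fin (c.support.card + 1) → (Fin d → ℝ) × ℝ :=
    Fin.cons 0 fun i => (e.symm i : (Fin d → ℝ) × ℝ)
  let co : Fin (c.support.card + 1) → ℝ := Fin.cons 0 fun i => c (e.symm i)
  refine ⟨⟨c.support.card + 1, Nat.succ_pos _, fun i => (w i).1, fun i => (w i).2, fun _ => co⟩,
    fun x => ?_⟩
  have hx : (c.sum fun i a => a • r i) x = ∑ i, co i * σ (∑ j, (w i).1 j * x.1 j + (w i).2) := by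
    rw [Fin.sum_univ_succ, ← e.sum_comp]
    simp [co, w, Finsupp.sum, r, ridge_apply, linForm]
    rw [← Finset.sum_coe_sort]
    rfl
  refine lt_of_eq_of_lt ?_ ((ContinuousMap.dist_lt_iff hδ).1 hga x)
  rw [hx, Real.dist_eq]; rfl

/-- Universal approximation by networks with one hidden layer. -/
lemma exists_shallowNet_near {m : ℕ} (K : Set (Fin d → ℝ)) (hK : IsCompact K) {σ : ℝ → ℝ}
    (hσ : Continuous σ) (hσ' : NonPolynomial σ) (g : Fin m → C(K, ℝ)) {δ : ℝ} (hδ : 0 < δ) :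
    ∃ ψ : ShallowNet d m, ∀ (k : Fin m) (x : K), |g k x - ψ.realize σ x k| < δ := by
  choose ψ hψ using fun k => exists_shallowNet_single_near K hK hσ hσ' (g k) hδ
  -- The hidden layers are put side by side; `none` is a zero unit, needed when `m = 0`.
  let ι := Option (Σ k, Fin (ψ k).N)
  let e := Fintype.equivFin ι
  let w : ι → Fin d → ℝ := fun i => i.elim 0 fun i => (ψ i.1).w i.2
  let h : ι → ℝ := fun i => i.elim 0 fun i => (ψ i.1).h i.2
  let c : Fin m → ι → ℝ := fun k i => i.elim 0 fun i => if i.1 = k then (ψ i.1).c 0 i.2 else 0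
  refine ⟨⟨Fintype.card ι, Fintype.card_pos, fun i => w (e.symm i), fun i => h (e.symm i),
    fun k i => c k (e.symm i)⟩, fun k x => ?_⟩
  convert hψ k x using 3
  simp only [ShallowNet.realize]
  rw [e.symm.sum_comp fun i => c k i * σ (∑ j, w i j * x.1 j + h i), Fintype.sum_option,
    Fintype.sum_sigma, Finset.sum_eq_single k]
  · simp [c, w, h]
  · intro k' _ hk'; simp [c, w, h, hk']
  · simp

end Universal

end GInvNet

open MvPolynomial

namespace GInvNet

/-! ### Generators modulo decomposables -/

section Nakayama

variable {s : Type*}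

/-- If `F` generates a subalgebra of polynomials, then modulo products of two elements without
constant term, the elements of the subalgebra without constant term are spanned by `F`. -/
lemma sub_constantCoeff_mem_of_mem_adjoin (F : Set (MvPolynomial s ℝ))
    (M : Submodule ℝ (MvPolynomial s ℝ)) (hM : ∀ p ∈ Algebra.adjoin ℝ F, p - C (constantCoeff p) ∈ M)
    (p : MvPolynomial s ℝ) (hp : p ∈ Algebra.adjoin ℝ F) :
    p - C (constantCoeff p) ∈
      Submodule.span ℝ ((fun q => q - C (constantCoeff q)) '' F) ⊔ M * M := by
  induction hp using Algebra.adjoin_induction with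
  | mem p hp => exact Submodule.mem_sup_left (Submodule.subset_span ⟨p, hp, rfl⟩)
  | algebraMap r => simp [MvPolynomial.algebraMap_eq]
  | add p q hp hq ihp ihq =>
    convert Submodule.add_mem _ ihp ihq using 1
    simp only [map_add]; ring
  | mul p q hp hq ihp ihq =>
    have h := Submodule.mem_sup_right (S := Submodule.span ℝ ((fun q => q - C (constantCoeff q)) '' F))
      (Submodule.mul_mem_mul (hM p hp) (hM q hq))
    -- With constant terms `p₀`, `q₀`: `pq - p₀q₀ = p₀(q - q₀) + q₀(p - p₀) + (p - p₀)(q - q₀)`.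
    convert Submodule.add_mem _ (Submodule.add_mem _ (Submodule.smul_mem _ (constantCoeff p) ihq)
      (Submodule.smul_mem _ (constantCoeff q) ihp)) h using 1
    simp only [map_mul, smul_eq_C_mul]; ring

/-- A family spanning `M` modulo `P` contains a family of at most `k` elements spanning `M`
modulo `P`, if `M` is spanned modulo `P` by `k` elements. -/
lemma exists_subfamily_span_sup {ι E : Type*} [AddCommGroup E] [Module ℝ E]
    (M P : Submodule ℝ E) (v : ι → E) (hv : Submodule.span ℝ (Set.range v) = M)
    (T : Finset E) (hT : M ≤ Submodule.span ℝ (T : Set E) ⊔ P) :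
    ∃ a : Finset ι, a.card ≤ T.card ∧ M ≤ Submodule.span ℝ (v '' a) ⊔ P := by
  classical
  -- A maximal independent subfamily modulo `P` has size at most the dimension of the span of the
  -- image of `T`.
  obtain ⟨κ, a, ha, hspan, hli⟩ := exists_linearIndependent' ℝ (P.mkQ ∘ v)
  let W := Submodule.span ℝ (P.mkQ '' (T : Set E))
  have : FiniteDimensional ℝ W := FiniteDimensional.span_of_finite ℝ (T.finite_toSet.image _)
  have hmem : ∀ i, (P.mkQ ∘ v) i ∈ W := fun i => by
    have h1 : v i ∈ M := hv ▸ Submodule.subset_span ⟨i, rfl⟩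
    have h2 := Submodule.mem_map_of_mem (f := P.mkQ) (hT h1)
    rw [Submodule.map_sup, Submodule.map_span, Submodule.mkQ_map_self, sup_bot_eq] at h2
    exact h2
  let u : κ → W := fun i => ⟨(P.mkQ ∘ v) (a i), hmem _⟩
  have hu : LinearIndependent ℝ u := LinearIndependent.of_comp W.subtype (by exact hli)
  have : Finite κ := hu.finite
  have := Fintype.ofFinite κ
  refine ⟨Finset.univ.image a, ?_, ?_⟩
  · calc _ ≤ Fintype.card κ := Finset.card_image_le
      _ ≤ Module.finrank ℝ W := hu.fintype_card_le_finrank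
      _ ≤ (T.image P.mkQ).card := by
        have := finrank_span_finset_le_card (R := ℝ) (T.image P.mkQ)
        rwa [Finset.coe_image] at this
      _ ≤ T.card := Finset.card_image_le
  · rw [← hv, Submodule.span_le]
    rintro _ ⟨i, rfl⟩
    have h1 : P.mkQ (v i) ∈ Submodule.span ℝ (Set.range ((P.mkQ ∘ v) ∘ a)) := by
      rw [hspan]; exact Submodule.subset_span ⟨i, rfl⟩
    have h2 : Set.range ((P.mkQ ∘ v) ∘ a) = P.mkQ '' (v '' (Finset.univ.image a : Finset ι)) := by
      ext; simp
    rw [h2, ← Submodule.map_span, ← Submodule.mem_comap, Submodule.comap_map_mkQ, sup_comm] at h1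
    exact h1

/-- Graded Nakayama lemma: if a family of homogeneous elements spans the elements without constant
term of a graded subalgebra `A` modulo products of two such elements, then it generates `A`. -/
lemma le_adjoin_of_le_span_sup_mul (A : Subalgebra ℝ (MvPolynomial s ℝ))
    (hA : ∀ p ∈ A, ∀ k, homogeneousComponent k p ∈ A) (S : Set (MvPolynomial s ℝ))
    (hS : ∀ p ∈ S, ∃ k, p.IsHomogeneous k) (M : Submodule ℝ (MvPolynomial s ℝ))
    (hM : ∀ p, p ∈ M ↔ p ∈ A ∧ constantCoeff p = 0)
    (h : M ≤ Submodule.span ℝ S ⊔ M * M) : A ≤ Algebra.adjoin ℝ S := by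
  classical
  have key : ∀ k, ∀ p ∈ A, homogeneousComponent k p ∈ Algebra.adjoin ℝ S := by
    intro k
    induction k using Nat.strong_induction_on with
    | _ k ih =>
      intro p hp
      rcases Nat.eq_zero_or_pos k with rfl | hk
      · rw [homogeneousComponent_zero]; exact Subalgebra.algebraMap_mem _ _
      set q := homogeneousComponent k p with hq
      have hqk : q.IsHomogeneous k := homogeneousComponent_isHomogeneous k p
      have hqM : q ∈ M := (hM q).2 ⟨hA p hp k, by
        rw [constantCoeff_eq, hq, coeff_homogeneousComponent, if_neg]; simpa using hk.ne⟩
      obtain ⟨u, hu, v, hv, huv⟩ := Submodule.mem_sup.1 (h hqM)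
      rw [← homogeneousComponent_eq_self hqk, ← huv, map_add]
      clear huv
      refine add_mem ?_ ?_
      · induction hu using Submodule.span_induction with
        | mem x hx =>
          obtain ⟨j, hj⟩ := hS x hx
          rw [homogeneousComponent_of_mem hj]
          split_ifs
          · exact Algebra.subset_adjoin hx
          · exact zero_mem _
        | zero => simp
        | add x y _ _ hx hy => rw [map_add]; exact add_mem hx hy
        | smul r x _ hx => rw [map_smul]; exact Subalgebra.smul_mem _ hx r
      · induction hv using Submodule.mul_induction_on' with
        | mem_mul_mem x hx y hy =>
          obtain ⟨hxA, hx0⟩ := (hM x).1 hx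
          obtain ⟨hyA, hy0⟩ := (hM y).1 hy
          rw [← sum_homogeneousComponent x, ← sum_homogeneousComponent y, Finset.sum_mul_sum, map_sum]
          refine sum_mem fun i _ => ?_
          rw [map_sum]
          refine sum_mem fun j _ => ?_
          rw [homogeneousComponent_of_mem ((homogeneousComponent_isHomogeneous i x).mul
            (homogeneousComponent_isHomogeneous j y))]
          split_ifs with hij
          -- Neither factor has a constant term, so only `i, j > 0` matter; as `i + j = k`, both are
          -- below `k` and the induction applies.
          · rcases Nat.eq_zero_or_pos i with rfl | hi
            · rw [homogeneousComponent_zero, ← constantCoeff_eq, hx0]; simp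
            rcases Nat.eq_zero_or_pos j with rfl | hj
            · rw [homogeneousComponent_zero, ← constantCoeff_eq, hy0]; simp
            exact mul_mem (ih i (by omega) x hxA) (ih j (by omega) y hyA)
          · exact zero_mem _
        | add x _ y _ hx hy => rw [map_add]; exact add_mem hx hy
  intro p hp
  rw [← sum_homogeneousComponent p]
  exact sum_mem fun k _ => key k p hp

end Nakayama

/-! ### Orbit sums of monomials as generators of the invariants -/

section OrbitSum

variable {n d : ℕ} (G : Subgroup (Equiv.Perm (Fin n)))

/-- The action of a permutation on the indices of the variables. -/
def indexAct (d : ℕ) (g : Equiv.Perm (Fin n)) (s : Fin n × Fin d) : Fin n × Fin d := (g s.1, s.2)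

lemma polyFun_rename_indexAct (g : Equiv.Perm (Fin n)) (p : MvPolynomial (Fin n × Fin d) ℝ)
    (x : Arr n d) : polyFun (rename (indexAct d g) p) x = polyFun p (permAct g x) := by
  rw [polyFun, eval_rename]; rfl

lemma mem_invariantPolys (p : MvPolynomial (Fin n × Fin d) ℝ) :
    p ∈ invariantPolys d G ↔ ∀ g ∈ G, rename (indexAct d g) p = p := by
  constructor
  · intro hp g hg
    refine MvPolynomial.funext fun x => ?_
    have := hp g hg (fun i j => x (i, j)) trivial trivial
    rw [← polyFun_rename_indexAct] at this
    exact this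
  · intro hp g hg x _ _
    rw [← polyFun_rename_indexAct, hp g hg]

lemma rename_indexAct_mul (g h : Equiv.Perm (Fin n)) (p : MvPolynomial (Fin n × Fin d) ℝ) :
    rename (indexAct d g) (rename (indexAct d h) p) = rename (indexAct d (g * h)) p := by
  rw [rename_rename]; rfl

open scoped Classical in
/-- The sum of the images of a polynomial under the elements of `G`. -/
noncomputable def orbitSum :
    MvPolynomial (Fin n × Fin d) ℝ →ₗ[ℝ] MvPolynomial (Fin n × Fin d) ℝ :=
  ∑ g : G, (rename (indexAct d (g : Equiv.Perm (Fin n)))).toLinearMap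

lemma orbitSum_apply (p : MvPolynomial (Fin n × Fin d) ℝ) [Fintype G] :
    orbitSum G p = ∑ g : G, rename (indexAct d (g : Equiv.Perm (Fin n))) p := by
  simp only [orbitSum, LinearMap.sum_apply, AlgHom.toLinearMap_apply]
  congr!

lemma orbitSum_mem (p : MvPolynomial (Fin n × Fin d) ℝ) : orbitSum G p ∈ invariantPolys d G := by
  classical
  rw [mem_invariantPolys]
  intro h hh
  rw [orbitSum_apply, map_sum]
  simp only [rename_indexAct_mul]
  exact Equiv.sum_comp (Equiv.mulLeft (⟨h, hh⟩ : G))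
    fun g : G => rename (indexAct d (g : Equiv.Perm (Fin n))) p

lemma orbitSum_of_mem {p : MvPolynomial (Fin n × Fin d) ℝ} (hp : p ∈ invariantPolys d G) :
    orbitSum G p = (Nat.card G : ℝ) • p := by
  classical
  rw [orbitSum_apply, Finset.sum_congr rfl fun g _ => (mem_invariantPolys G p).1 hp _ (SetLike.coe_mem g)]
  simp [Nat.card_eq_fintype_card, Nat.cast_smul_eq_nsmul]

lemma isHomogeneous_orbitSum {p : MvPolynomial (Fin n × Fin d) ℝ} {k : ℕ}
    (hp : p.IsHomogeneous k) : (orbitSum G p).IsHomogeneous k := by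
  classical
  rw [orbitSum_apply]
  exact IsHomogeneous.sum _ _ _ fun g _ => hp.rename_isHomogeneous

/-- The invariant polynomials without constant term. -/
noncomputable def augmentation (d : ℕ) : Submodule ℝ (MvPolynomial (Fin n × Fin d) ℝ) :=
  (invariantPolys d G).toSubmodule ⊓ LinearMap.ker (lcoeff ℝ (0 : Fin n × Fin d →₀ ℕ))

lemma mem_augmentation (p : MvPolynomial (Fin n × Fin d) ℝ) :
    p ∈ augmentation G d ↔ p ∈ invariantPolys d G ∧ constantCoeff p = 0 := by
  rw [constantCoeff_eq]; rfl

lemma homogeneousComponent_mem_invariantPolys {p : MvPolynomial (Fin n × Fin d) ℝ}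
    (hp : p ∈ invariantPolys d G) (k : ℕ) : homogeneousComponent k p ∈ invariantPolys d G := by
  rw [mem_invariantPolys] at hp ⊢
  intro g hg
  rw [rename_homogeneousComponent, hp g hg]

/-- The orbit sums of nonconstant monomials span the invariants without constant term. -/
lemma span_orbitSum_eq_augmentation :
    Submodule.span ℝ (Set.range fun a : {a : Fin n × Fin d →₀ ℕ // a ≠ 0} =>
      orbitSum G (monomial a.1 (1 : ℝ))) = augmentation G d := by
  classical
  apply le_antisymm
  · rw [Submodule.span_le]
    rintro _ ⟨a, rfl⟩
    refine (mem_augmentation G _).2 ⟨orbitSum_mem G _, ?_⟩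
    have := isHomogeneous_orbitSum G (isHomogeneous_monomial (1 : ℝ) (rfl : a.1.degree = _))
    rw [constantCoeff_eq]
    exact this.coeff_eq_zero (by simpa [eq_comm (a := 0), Finsupp.degree_eq_zero_iff] using a.2)
  · intro p hp
    obtain ⟨hpA, hp0⟩ := (mem_augmentation G p).1 hp
    have hcard : (Nat.card G : ℝ) ≠ 0 := by exact_mod_cast Nat.card_pos.ne'
    -- Averaging over `G` fixes an invariant, so expanding `p` into monomials suffices.
    have hp' : p = (Nat.card G : ℝ)⁻¹ • orbitSum G p := by
      rw [orbitSum_of_mem G hpA, smul_smul, inv_mul_cancel₀ hcard, one_smul]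
    rw [hp']
    refine Submodule.smul_mem _ _ ?_
    rw [p.as_sum, map_sum]
    refine Submodule.sum_mem _ fun a ha => ?_
    have ha0 : a ≠ 0 := by
      rintro rfl
      exact (mem_support_iff.1 ha) (by rw [← constantCoeff_eq]; exact hp0)
    have : monomial a (coeff a p) = coeff a p • monomial a (1 : ℝ) := by
      rw [smul_monomial, smul_eq_mul, mul_one]
    rw [this, map_smul]
    exact Submodule.smul_mem _ _ (Submodule.subset_span ⟨⟨a, ha0⟩, rfl⟩)

/-- If the algebra of invariants is generated by at most `m` polynomials, then it is generated by
the orbit sums of `m` monomials. -/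
lemma exists_orbitSum_generators (F : Finset (MvPolynomial (Fin n × Fin d) ℝ))
    (hF : Algebra.adjoin ℝ (F : Set (MvPolynomial (Fin n × Fin d) ℝ)) = invariantPolys d G)
    {m : ℕ} (hm : F.card ≤ m) :
    ∃ a : Fin m → (Fin n × Fin d →₀ ℕ), invariantPolys d G ≤
      Algebra.adjoin ℝ (Set.range fun k => orbitSum G (monomial (a k) (1 : ℝ))) := by
  classical
  have hsub : ∀ p ∈ invariantPolys d G, p - C (constantCoeff p) ∈ augmentation G d := fun p hp =>
    (mem_augmentation G _).2 ⟨sub_mem hp (Subalgebra.algebraMap_mem _ _), by simp⟩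
  obtain ⟨b, hb, hspan⟩ := exists_subfamily_span_sup (augmentation G d)
    (augmentation G d * augmentation G d) _ (span_orbitSum_eq_augmentation G)
    (F.image fun q => q - C (constantCoeff q)) (by
      intro p hp
      obtain ⟨hpA, hp0⟩ := (mem_augmentation G p).1 hp
      have := sub_constantCoeff_mem_of_mem_adjoin (F : Set _) (augmentation G d)
        (fun p hp => hsub p (hF ▸ hp)) p (hF ▸ hpA)
      rw [hp0, map_zero, sub_zero] at this
      rwa [Finset.coe_image])
  have hbm : b.card ≤ m := hb.trans (Finset.card_image_le.trans hm)
  let e := b.equivFin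
  -- Unused slots get exponent `0`; the extra constant generators are harmless.
  refine ⟨fun k => if h : k.1 < b.card then (e.symm ⟨k, h⟩).1.1 else 0, ?_⟩
  refine (le_adjoin_of_le_span_sup_mul (invariantPolys d G)
    (fun p hp k => homogeneousComponent_mem_invariantPolys G hp k) _ ?_ _
    (mem_augmentation G) hspan).trans (Algebra.adjoin_mono ?_)
  · rintro _ ⟨a, _, rfl⟩
    exact ⟨_, isHomogeneous_orbitSum G (isHomogeneous_monomial (1 : ℝ) rfl)⟩
  · rintro _ ⟨a, ha, rfl⟩
    refine ⟨⟨e ⟨a, ha⟩, (e ⟨a, ha⟩).2.trans_le hbm⟩, ?_⟩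
    simp

end OrbitSum

/-! ### Separation of orbits -/

section Separation

variable {n d : ℕ} (G : Subgroup (Equiv.Perm (Fin n)))

/-- The invariant polynomials separate the orbits of `G`. -/
lemma exists_permAct_eq_of_polyFun_eq (x y : Arr n d)
    (h : ∀ p ∈ invariantPolys d G, polyFun p x = polyFun p y) : ∃ g ∈ G, permAct g x = y := by
  classical
  -- The product of the squared distances to the points of the orbit of `x`: it is invariant and
  -- vanishes exactly on that orbit.
  let Q : MvPolynomial (Fin n × Fin d) ℝ :=
    ∏ g : G, ∑ s : Fin n × Fin d, (X s - C (permAct (g : Equiv.Perm (Fin n)) x s.1 s.2)) ^ 2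
  have hQe : ∀ z, polyFun Q z =
      ∏ g : G, ∑ s : Fin n × Fin d, (z s.1 s.2 - permAct (g : Equiv.Perm (Fin n)) x s.1 s.2) ^ 2 :=
    fun z => by simp [polyFun, Q]
  have hQ : Q ∈ invariantPolys d G := by
    intro g hg z _ _
    rw [hQe, hQe]
    exact (Equiv.prod_comp (Equiv.mulRight (⟨g, hg⟩ : G)) _).symm.trans
      (Finset.prod_congr rfl fun k _ => Equiv.sum_comp (Equiv.prodCongr g (Equiv.refl (Fin d)))
        fun s => (z s.1 s.2 - permAct (k : Equiv.Perm (Fin n)) x s.1 s.2) ^ 2)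
  have hx : polyFun Q x = 0 := by
    rw [hQe]
    exact Finset.prod_eq_zero (Finset.mem_univ 1) (by simp [permAct])
  have hy := (h Q hQ).symm.trans hx
  rw [hQe, Finset.prod_eq_zero_iff] at hy
  obtain ⟨g, -, hg⟩ := hy
  refine ⟨g, g.2, funext fun i => funext fun j => ?_⟩
  have := (Finset.sum_eq_zero_iff_of_nonneg fun s _ => sq_nonneg _).1 hg (i, j) (Finset.mem_univ _)
  exact (sub_eq_zero.1 (pow_eq_zero_iff two_ne_zero |>.1 this)).symm

end Separation

end GInvNet

open Filter Topology MvPolynomial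

namespace GInvNet

/-! ### Sum-product layer, factorization and continuity -/

section Approximation

variable {n d m : ℕ} (G : Subgroup (Equiv.Perm (Fin n)))

/-- The factor of a monomial in the variables of the `j`-th row. -/
def rowMonomial (a : Fin m → (Fin n × Fin d →₀ ℕ)) (j : Fin n) (z : Fin d → ℝ) : Fin m → ℝ :=
  fun k => ∏ l, z l ^ a k (j, l)

lemma continuous_rowMonomial (a : Fin m → (Fin n × Fin d →₀ ℕ)) (j : Fin n) :
    Continuous (rowMonomial a j) :=
  continuous_pi fun _ => continuous_finsetProd _ fun l _ => (continuous_apply l).pow _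

/-- A monomial is the product of its row factors, and renaming by `g` evaluates the `j`-th factor at
row `g j`. -/
lemma polyFun_orbitSum_monomial (a : Fin m → (Fin n × Fin d →₀ ℕ)) (x : Arr n d) (k : Fin m) :
    polyFun (orbitSum G (monomial (a k) (1 : ℝ))) x = sumProd G (fIn (rowMonomial a) x) k := by
  classical
  rw [orbitSum_apply, sumProd, Finset.sum_apply, polyFun, map_sum]
  convert Finset.sum_congr rfl fun g _ => ?_ using 1
  rw [eval_rename, eval_monomial, one_mul, Finsupp.prod_fintype _ _ (by simp), Finset.prod_apply,
    Fintype.prod_prod_type]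
  rfl

lemma continuous_sumProd : Continuous (sumProd G : (Fin n → Fin n → Fin m → ℝ) → Fin m → ℝ) := by
  classical
  unfold sumProd
  fun_prop

lemma continuous_fIn {φ : Fin n → (Fin d → ℝ) → (Fin m → ℝ)} (hφ : ∀ j, Continuous (φ j)) :
    Continuous (fIn φ : Arr n d → _) :=
  continuous_pi fun i => continuous_pi fun j => (hφ j).comp (continuous_apply i)

lemma ShallowNet.continuous_realize {σ : ℝ → ℝ} (hσ : Continuous σ) (φ : ShallowNet d m) :
    Continuous (φ.realize σ) := by
  unfold ShallowNet.realize
  fun_prop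

/-- A continuous map on a compact set that is constant on the fibres of a continuous map `π`
factors through the image of `π`. -/
lemma exists_continuous_factor {E E' : Type*} [TopologicalSpace E] [TopologicalSpace E']
    [T2Space E'] {V : Set E} (hV : IsCompact V) {f : E → ℝ} (hf : ContinuousOn f V) {π : E → E'}
    (hπ : Continuous π) (h : ∀ x ∈ V, ∀ y ∈ V, π x = π y → f x = f y) :
    ∃ g : C(π '' V, ℝ), ∀ (x : E) (hx : x ∈ V), g ⟨π x, x, hx, rfl⟩ = f x := by
  have := isCompact_iff_compactSpace.1 hV
  let q : C(V, π '' V) := ⟨fun x => ⟨π x.1, x.1, x.2, rfl⟩, by fun_prop⟩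
  -- A continuous surjection from a compact space to a Hausdorff one is closed, hence a quotient
  -- map.
  have hq : Topology.IsQuotientMap q := q.continuous.isClosedMap.isQuotientMap q.continuous (by
    rintro ⟨_, x, hx, rfl⟩; exact ⟨⟨x, hx⟩, rfl⟩)
  have hfac : Function.FactorsThrough (⟨V.domRestrict f, hf.domRestrict⟩ : C(V, ℝ)) q :=
    fun x y hxy => h x x.2 y y.2 (congrArg Subtype.val hxy)
  exact ⟨hq.lift _ hfac, fun x hx => congrFun
    (congrArg DFunLike.coe (hq.lift_comp (⟨V.domRestrict f, hf.domRestrict⟩ : C(V, ℝ)) hfac)) ⟨x, hx⟩⟩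

/-- A continuous map is uniformly continuous near a compact set. -/
lemma exists_dist_lt_of_isCompact {E E' : Type*} [PseudoMetricSpace E] [PseudoMetricSpace E']
    {C : Set E} (hC : IsCompact C) {Φ : E → E'} (hΦ : Continuous Φ) {ε : ℝ} (hε : 0 < ε) :
    ∃ δ > 0, ∀ y ∈ C, ∀ z, dist y z < δ → dist (Φ y) (Φ z) < ε := by
  have h := hC.uniformContinuousAt_of_continuousAt Φ (fun y _ => hΦ.continuousAt)
    (Metric.dist_mem_uniformity hε)
  obtain ⟨δ, hδ, hd⟩ := Metric.mem_uniformity_dist.1 h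
  exact ⟨δ, hδ, fun y hy z hyz => hd hyz hy⟩

end Approximation

end GInvNet

open GInvNet

/-! ### Assembly of the network -/

theorem proposition1 (n nIn nMid : ℕ) (G : Subgroup (Equiv.Perm (Fin n)))
    (τ σ : ℝ → ℝ) (hτ : Continuous τ) (hτ' : GInvNet.NonPolynomial τ)
    (hσ : Continuous σ) (hσ' : GInvNet.NonPolynomial σ)
    (F : Finset (MvPolynomial (Fin n × Fin nIn) ℝ))
    (hF : Algebra.adjoin ℝ (F : Set (MvPolynomial (Fin n × Fin nIn) ℝ)) =
      GInvNet.invariantPolys nIn G)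
    (hMid : F.card ≤ nMid)
    (V : Set (GInvNet.Arr n nIn)) (hV : IsCompact V)
    (f : GInvNet.Arr n nIn → ℝ) (hf : ContinuousOn f V) (hfG : GInvNet.InvariantOn G V f)
    (ε : ℝ) (hε : 0 < ε) :
    ∃ (φ : Fin n → GInvNet.ShallowNet nIn nMid) (ψ : GInvNet.ShallowNet nMid 1),
      ∀ x ∈ V, |f x - GInvNet.network τ σ G φ ψ x 0| < ε := by
  obtain ⟨a, ha⟩ := exists_orbitSum_generators G F hF hMid
  let Y : Arr n nIn → Fin n → Fin n → Fin nMid → ℝ := fIn (rowMonomial a)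
  have hY : Continuous Y := continuous_fIn (continuous_rowMonomial a)
  have hπ : Continuous fun x => sumProd G (Y x) := (continuous_sumProd G).comp hY
  obtain ⟨g, hg⟩ := exists_continuous_factor hV hf hπ (by
    intro x hx y hy hxy
    have hp : ∀ p ∈ invariantPolys nIn G, polyFun p x = polyFun p y := by
      intro p hp
      replace hp := ha hp
      induction hp using Algebra.adjoin_induction with
      | mem p hp =>
        obtain ⟨k, rfl⟩ := hp
        rw [polyFun_orbitSum_monomial, polyFun_orbitSum_monomial]
        exact congrFun hxy k
      | algebraMap r => simp [polyFun, MvPolynomial.algebraMap_eq]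
      | add p q _ _ hp hq => simp only [polyFun, map_add] at *; rw [hp, hq]
      | mul p q _ _ hp hq => simp only [polyFun, map_mul] at *; rw [hp, hq]
    obtain ⟨h, hhG, rfl⟩ := exists_permAct_eq_of_polyFun_eq G x y hp
    exact (hfG h hhG x hx hy).symm)
  obtain ⟨ψ, hψ⟩ := exists_shallowNet_single_near _ (hV.image hπ) hσ hσ' g (half_pos hε)
  -- The approximate features may leave `Y '' V`, so continuity must be uniform around this set, not
  -- only on it.
  obtain ⟨δ, hδ, hδψ⟩ := exists_dist_lt_of_isCompact (hV.image hY)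
    ((ψ.continuous_realize hσ).comp (continuous_sumProd G)) (half_pos hε)
  -- Every `φ j` is applied to every row, so `K` collects all rows of points of `V`.
  let K : Set (Fin nIn → ℝ) := ⋃ i : Fin n, (fun x : Arr n nIn => x i) '' V
  have hK : IsCompact K := isCompact_iUnion fun i => hV.image (continuous_apply i)
  choose φ hφ using fun j => exists_shallowNet_near K hK hτ hτ'
    (fun k => ⟨fun z : K => rowMonomial a j z k,
      (continuous_apply k).comp ((continuous_rowMonomial a j).comp continuous_subtype_val)⟩) hδ
  refine ⟨φ, ψ, fun x hx => ?_⟩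
  have hxK : ∀ i, x i ∈ K := fun i => Set.mem_iUnion.2 ⟨i, x, hx, rfl⟩
  have hclose : dist (Y x) (fIn (fun j => (φ j).realize τ) x) < δ := by
    simp only [dist_pi_lt_iff hδ]
    exact fun i j k => hφ j k ⟨x i, hxK i⟩
  have h1 := hψ ⟨_, x, hx, rfl⟩
  rw [hg x hx] at h1
  have h2 := (dist_pi_lt_iff (half_pos hε)).1 (hδψ _ ⟨x, hx, rfl⟩ _ hclose) 0
  calc _ ≤ _ := abs_sub_le _ (ψ.realize σ (sumProd G (Y x)) 0) _
    _ < ε / 2 + ε / 2 := add_lt_add h1 h2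
    _ = ε := add_halves ε
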